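/- Let $\theta_0,\tau_3,\kappa$ be nonzero complex numbers, put $\delta_0=\tau_3^2-\tau_3+1$ and $\delta=\delta_0+\theta_0$, and let $E_{ij}$ ($i,j\in\{0,1,2\}$) be the elementary $3\times 3$ matrices. The (twisted) generalized SpR Hamiltonian is the two-site operator on $\mathbb C^3\otimes\mathbb C^3$ $$\begin{aligned} H={}&E_{01}\otimes E_{10}+\theta_0\,E_{10}\otimes E_{01}+\kappa\,E_{21}\otimes E_{01}+\tfrac{\theta_0\tau_3}{\kappa}\,E_{12}\otimes E_{10}+\tfrac{\kappa}{\theta_0}\,E_{01}\otimes E_{21}+\tfrac{\theta_0^2\tau_3}{\kappa}\,E_{10}\otimes E_{12}\\ &+\tau_3\,E_{12}\otimes E_{21}+\theta_0\tau_3\,E_{21}\otimes E_{12}+E_{02}\otimes E_{20}+\theta_0\delta_0\,E_{20}\otimes E_{02}\\ &+\tfrac{\delta}{4}\big(E_{00}\otimes E_{00}+E_{00}\otimes E_{22}-E_{11}\otimes E_{11}+E_{22}\otimes E_{00}+E_{22}\otimes E_{22}\big), \end{aligned}$$ where $\kappa$ is a gauge parameter, and where the shifts of $H$ by the identity and by $S^z$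 are fixed so that $v_{00}=v_{22}$ and $v_{01}+v_{10}=v_{12}+v_{21}=0$. A regular $R$-matrix with a single multiplicative spectral parameter for a two-site Hamiltonian $h$ is a matrix function $\check R(u)$ on $\mathbb C^3\otimes\mathbb C^3$, analytic around $u=1$, with $\check R(1)=\mathbb I$ and $\check R'(1)=h$, which satisfies $$\check R_{12}(u)\check R_{23}(uv)\check R_{12}(v)=\check R_{23}(v)\check R_{12}(uv)\check R_{23}(u)$$ for all $(u,v)$ near $(1,1)$. Let $R=P\check R$ with $P$ the permutation operator, and let $f_{11}$ and $f_{99}$ be the first and the last diagonal entries of $R$, i.e. those at $|00\rangle$ and $|22\rangle$. 1. Let $\alpha\in\mathbb C$ and let $A$ be a diagonal $3\times3$ matrix. If $H+\alpha\,\mathbb I+A\otimes\mathbb I-\mathbb I\otimes A$ has such an $R$-matrix, then $f_{11}(u)=\tau_3^2f_{99}(u)$ for $u$ near $1$, $\tau_3^2=1$ and $\theta_0=\tau_3^2-\tau_3+1$. 2. Consequently, unless $\tau_3^2=1$ and $\theta_0=\tau_3^2-\tau_3+1$, there is no regular $R$-matrix with a single multiplicative spectral parameter for $H$, nor for any $H+\alpha\,\mathbb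 I+A\otimes\mathbb I-\mathbb I\otimes A$. 3. For generic parameters, namely whenever $\theta_0\ne\tau_3^2-\tau_3+1$, there is no such $R$-matrix even for any Hamiltonian $H+\alpha\,\mathbb I+\beta\,(\mathfrak s^z\otimes\mathbb I+\mathbb I\otimes\mathfrak s^z)+A\otimes\mathbb I-\mathbb I\otimes A$ with $\alpha,\beta\in\mathbb C$, $A$ diagonal and $\mathfrak s^z=\mathrm{diag}(0,1,2)$. -/

import Mathlib

open Filter Topology
open scoped Kronecker

noncomputable section

/-- Operators on the two-site space `ℂ³ ⊗ ℂ³`; the index `(i, j)` stands for `|i⟩ ⊗ |j⟩`. -/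
abbrev TwoSite := Matrix (Fin 3 × Fin 3) (Fin 3 × Fin 3) ℂ

/-- Operators on the three-site space `ℂ³ ⊗ ℂ³ ⊗ ℂ³`. -/
abbrev ThreeSite := Matrix (Fin 3 × Fin 3 × Fin 3) (Fin 3 × Fin 3 × Fin 3) ℂ

/-- The elementary `3 × 3` matrix `E_{ij}`. -/
def elemE (i j : Fin 3) : Matrix (Fin 3) (Fin 3) ℂ := Matrix.single i j 1

/-- `M₁₂ = M ⊗ 𝕀`: the operator `M` acting on sites 1 and 2. -/
def onSites12 (M : TwoSite) : ThreeSite :=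
  Matrix.of fun x y => if x.2.2 = y.2.2 then M (x.1, x.2.1) (y.1, y.2.1) else 0

/-- `M₂₃ = 𝕀 ⊗ M`: the operator `M` acting on sites 2 and 3. -/
def onSites23 (M : TwoSite) : ThreeSite :=
  Matrix.of fun x y => if x.1 = y.1 then M x.2 y.2 else 0

/-- The general `U(1)`-invariant two-site Hamiltonian of a three-state chain with at most
19 nonzero entries. -/
def vertexHamiltonian (p q t₁ s₁ t₂ s₂ t₃ s₃ tp sp : ℂ) (v : Matrix (Fin 3) (Fin 3) ℂ) :
    TwoSite :=
  p • (elemE 0 1 ⊗ₖ elemE 1 0) + q • (elemE 1 0 ⊗ₖ elemE 0 1)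
    + t₁ • (elemE 2 1 ⊗ₖ elemE 0 1) + s₁ • (elemE 1 2 ⊗ₖ elemE 1 0)
    + t₂ • (elemE 0 1 ⊗ₖ elemE 2 1) + s₂ • (elemE 1 0 ⊗ₖ elemE 1 2)
    + t₃ • (elemE 1 2 ⊗ₖ elemE 2 1) + s₃ • (elemE 2 1 ⊗ₖ elemE 1 2)
    + tp • (elemE 0 2 ⊗ₖ elemE 2 0) + sp • (elemE 2 0 ⊗ₖ elemE 0 2)
    + ∑ i : Fin 3, ∑ j : Fin 3, v i j • (elemE i i ⊗ₖ elemE j j)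

/-- The two-site Hamiltonian of the generalized SpR model, with parameters `θ₀ = q t_p² / p³` and
`τ₃ = t₃ / p`, normalized by `p = t_p = 1`. Here `δ₀ = τ₃² - τ₃ + 1`, `δ = δ₀ + θ₀`, and `κ ≠ 0` is
the parameter of the gauge transformations by `g ⊗ g`, `g` diagonal. The diagonal is normalized by
a shift by the identity and by `S^z`, so that the two reference states `|00⟩` and `|22⟩` have the
same energy and `v₀₁ = v₁₀ = v₁₂ = v₂₁ = 0`. -/
def spRHamiltonian (θ₀ τ₃ κ : ℂ) : TwoSite :=
  let δ₀ : ℂ := τ₃ ^ 2 - τ₃ + 1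
  let δ : ℂ := δ₀ + θ₀
  vertexHamiltonian 1 θ₀
    κ (θ₀ * τ₃ / κ)
    (κ / θ₀) (θ₀ ^ 2 * τ₃ / κ)
    τ₃ (θ₀ * τ₃)
    1 (θ₀ * δ₀)
    !![δ / 4, 0, δ / 4; 0, -(δ / 4), 0; δ / 4, 0, δ / 4]

/-- The spin generator `𝔰^z |j⟩ = j |j⟩`. -/
def spinZ : Matrix (Fin 3) (Fin 3) ℂ := Matrix.diagonal fun j => ((j : ℕ) : ℂ)

/-- The two-site term of the total spin. -/
def twoSiteSpin : TwoSite :=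
  spinZ ⊗ₖ (1 : Matrix (Fin 3) (Fin 3) ℂ) + (1 : Matrix (Fin 3) (Fin 3) ℂ) ⊗ₖ spinZ

/-- The telescopic term `A ⊗ 𝕀 - 𝕀 ⊗ A` with `A = diag(a 0, a 1, a 2)`. -/
def telescopic (a : Fin 3 → ℂ) : TwoSite :=
  Matrix.diagonal a ⊗ₖ (1 : Matrix (Fin 3) (Fin 3) ℂ)
    - (1 : Matrix (Fin 3) (Fin 3) ℂ) ⊗ₖ Matrix.diagonal a

/-- `Rc` is a (braided) regular `R`-matrix with one multiplicative spectral parameter from which the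
two-site Hamiltonian `H` derives: `Rc` is analytic around `u = 1`, satisfies
`Rc(1) = 𝕀` and `Rc'(1) = H`, and satisfies the braided Yang–Baxter equation
`Rc₁₂(u) Rc₂₃(uv) Rc₁₂(v) = Rc₂₃(v) Rc₁₂(uv) Rc₂₃(u)` for `(u, v)` near `(1, 1)`. -/
structure IsRegularRMatrixFor (H : TwoSite) (Rc : ℂ → TwoSite) : Prop where
  analytic : ∀ x y, AnalyticAt ℂ (fun u => Rc u x y) 1
  regular : Rc 1 = 1
  hamiltonian : ∀ x y, HasDerivAt (fun u => Rc u x y) (H x y) 1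
  yangBaxter : ∀ᶠ w : ℂ × ℂ in 𝓝 (1, 1),
    onSites12 (Rc w.1) * onSites23 (Rc (w.1 * w.2)) * onSites12 (Rc w.2)
      = onSites23 (Rc w.2) * onSites12 (Rc (w.1 * w.2)) * onSites23 (Rc w.1)

/-- The non-braided matrix `R = P Rc`, where `P` is the permutation operator of `ℂ³ ⊗ ℂ³`. -/
def unbraid (M : TwoSite) : TwoSite := M.submatrix Prod.swap id

end

/-! Differentiating the braided Yang–Baxter equation in `v` at `1` gives the Sutherland equation, a
first-order equation for `R` with coefficient `H`. Its Taylor expansion at `u = 1` determines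
`R''(1)` up to a scalar. At the next order it yields the Reshetikhin condition: `[H₁₂ + H₂₃, [H₁₂,
H₂₃]] = X₁₂ - X₂₃` for some two-site `X` (`SolvesSutherland.reshetikhin`). Entries that change both
outer sites do not see `X`, so they must vanish on the left. Three of them give `2a₁ = a₀ + a₂`, `θ₀
= τ₃² - τ₃ + 1` and `τ₃² = 1 + 2β`. The second does not involve `β`, which settles the generic
statement.

It remains to compare `f₁₁` with `f₉₉` when `τ₃² = 1`. The Sutherland equation determines `R` up to
a scalar function (`IsRegularRMatrixFor.eventually_proportional`), so every symmetry of `H`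
compatible with Yang–Baxter is inherited by `R` up to a factor. At these parameters `H` is invariant
under a twisted charge conjugation combined with site exchange (`shiftedSpRHamiltonian_symmetric`),
which interchanges `|00⟩` and `|22⟩`. Proportionality then gives `f₁₁² = f₉₉²`, and regularity
selects `f₁₁ = f₉₉`. -/

open scoped Matrix.Norms.Operator

/-! ### Site embeddings and entrywise calculus. -/

/-- `onSites12` as a continuous linear map. -/
noncomputable def onSites12L : TwoSite →L[ℂ] ThreeSite :=
  LinearMap.toContinuousLinearMap
    { toFun := onSites12
      map_add' := fun M N => by
        ext x y; simp only [onSites12, Matrix.of_apply, Matrix.add_apply]; split_ifs <;> simp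
      map_smul' := fun c M => by
        ext x y; simp only [onSites12, Matrix.of_apply, Matrix.smul_apply]; split_ifs <;> simp }

/-- `onSites23` as a continuous linear map. -/
noncomputable def onSites23L : TwoSite →L[ℂ] ThreeSite :=
  LinearMap.toContinuousLinearMap
    { toFun := onSites23
      map_add' := fun M N => by
        ext x y; simp only [onSites23, Matrix.of_apply, Matrix.add_apply]; split_ifs <;> simp
      map_smul' := fun c M => by
        ext x y; simp only [onSites23, Matrix.of_apply, Matrix.smul_apply]; split_ifs <;> simp }

theorem onSites12L_apply (M : TwoSite) : onSites12L M = onSites12 M := rfl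

theorem onSites23L_apply (M : TwoSite) : onSites23L M = onSites23 M := rfl

theorem onSites12_one : onSites12 1 = 1 := by
  ext ⟨a, b, c⟩ ⟨d, e, f⟩
  simp only [onSites12, Matrix.of_apply, Matrix.one_apply, Prod.mk.injEq]
  grind

theorem onSites23_one : onSites23 1 = 1 := by
  ext ⟨a, b, c⟩ ⟨d, e, f⟩
  simp only [onSites23, Matrix.of_apply, Matrix.one_apply, Prod.mk.injEq]
  grind

theorem onSites12L_one : onSites12L 1 = 1 := onSites12_one

theorem onSites23L_one : onSites23L 1 = 1 := onSites23_one

/-- An operator that acts in the same way on sites 1, 2 and on sites 2, 3 is scalar. -/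
theorem eq_smul_one_of_onSites12_eq_onSites23 {D : TwoSite} (h : onSites12 D = onSites23 D) :
    D = D (0, 0) (0, 0) • (1 : TwoSite) := by
  have key : ∀ a b c d e f : Fin 3, (if c = f then D (a, b) (d, e) else 0)
      = if a = d then D (b, c) (e, f) else 0 := fun a b c d e f =>
    congrFun (congrFun h (a, b, c)) (d, e, f)
  ext ⟨a, b⟩ ⟨d, e⟩
  have h1 := key a b 0 d e 0
  have h2 := key 0 b 0 0 e 0
  have h3 := key b 0 0 e 0 0
  simp only [Matrix.smul_apply, Matrix.one_apply, Prod.mk.injEq, smul_eq_mul]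
  simp only [if_true] at h1 h2 h3
  rw [h1, h3]
  split_ifs <;> simp_all

theorem analyticAt_matrix_iff {n : Type*} [Fintype n] [DecidableEq n]
    {F : ℂ → Matrix n n ℂ} {z : ℂ} :
    AnalyticAt ℂ F z ↔ ∀ x y, AnalyticAt ℂ (fun u => F u x y) z := by
  constructor
  · intro h x y
    exact ((LinearMap.toContinuousLinearMap
      (Matrix.entryLinearMap ℂ ℂ x y)).analyticAt _).comp h
  · intro h
    have : F = fun u => ∑ x, ∑ y, F u x y • Matrix.single x y (1 : ℂ) := by
      funext u
      conv_lhs => rw [Matrix.matrix_eq_sum_single (F u)]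
      simp [Matrix.smul_single]
    rw [this]
    exact Finset.analyticAt_fun_sum _ fun x _ => Finset.analyticAt_fun_sum _ fun y _ =>
      (h x y).smul analyticAt_const

theorem HasDerivAt.matrix_apply {n : Type*} [Fintype n] [DecidableEq n]
    {F : ℂ → Matrix n n ℂ} {F' : Matrix n n ℂ} {z : ℂ} (h : HasDerivAt F F' z) (x y : n) :
    HasDerivAt (fun u => F u x y) (F' x y) z :=
  (LinearMap.toContinuousLinearMap
      (Matrix.entryLinearMap ℂ ℂ x y)).hasFDerivAt.comp_hasDerivAt z h

/-! ### Sutherland equation and Reshetikhin condition. -/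

section NormedAlgebra

variable {𝔸 : Type*} [NormedRing 𝔸] [NormedAlgebra ℂ 𝔸]

/-- Differentiating the braided Yang–Baxter equation in its second parameter at `1`. -/
theorem sutherland_of_yangBaxter {P Q : ℂ → 𝔸} {u : ℂ} {A B P' Q' : 𝔸}
    (hP1 : P 1 = 1) (hQ1 : Q 1 = 1) (hA : HasDerivAt P A 1) (hB : HasDerivAt Q B 1)
    (hP : HasDerivAt P P' u) (hQ : HasDerivAt Q Q' u)
    (h : ∀ᶠ v in 𝓝 (1 : ℂ), P u * Q (u * v) * P v = Q v * P (u * v) * Q u) :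
    u • (P' * Q u - P u * Q') = P u * Q u * A - B * P u * Q u := by
  have hu : HasDerivAt (fun v : ℂ => u * v) u 1 := by
    simpa using (hasDerivAt_id (1 : ℂ)).const_mul u
  have a1 : HasDerivAt (fun v => P (u * v)) (u • P') 1 :=
    HasDerivAt.scomp (1 : ℂ) (by rwa [mul_one]) hu
  have b1 : HasDerivAt (fun v => Q (u * v)) (u • Q') 1 :=
    HasDerivAt.scomp (1 : ℂ) (by rwa [mul_one]) hu
  have l := (b1.const_mul (P u)).mul hA
  have r := (hB.mul a1).mul (hasDerivAt_const (1 : ℂ) (Q u))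
  have e := l.unique (r.congr_of_eventuallyEq h)
  simp only [Pi.mul_apply, mul_one, hP1, hQ1, one_mul, mul_zero, add_zero, smul_mul_assoc,
    mul_smul_comm, add_mul] at e
  rw [smul_sub, sub_eq_sub_iff_add_eq_add, add_comm (P u * Q u * A), e, add_comm]

/-- Differentiating the Sutherland equation. -/
theorem sutherland_deriv {P Q P₁ Q₁ : ℂ → 𝔸} {u : ℂ} {A B P₂ Q₂ : 𝔸}
    (hP : HasDerivAt P (P₁ u) u) (hQ : HasDerivAt Q (Q₁ u) u)
    (hP₁ : HasDerivAt P₁ P₂ u) (hQ₁ : HasDerivAt Q₁ Q₂ u)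
    (h : ∀ᶠ v in 𝓝 u, v • (P₁ v * Q v - P v * Q₁ v) = P v * Q v * A - B * P v * Q v) :
    P₁ u * Q u - P u * Q₁ u + u • (P₂ * Q u - P u * Q₂)
      = (P₁ u * Q u + P u * Q₁ u) * A - B * (P₁ u * Q u + P u * Q₁ u) := by
  have l := (hasDerivAt_id u).smul ((hP₁.mul hQ).sub (hP.mul hQ₁))
  have r := ((hP.mul hQ).mul_const A).sub (((hP.const_mul B).mul hQ))
  have e := l.unique (r.congr_of_eventuallyEq h)
  simp only [id, Pi.mul_apply, Pi.sub_apply, one_smul] at e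
  rw [add_comm] at e
  convert e using 1
  · congr 2; abel
  · noncomm_ring

/-- Differentiating the Sutherland equation twice. -/
theorem sutherland_deriv_deriv {P Q P₁ Q₁ P₂ Q₂ : ℂ → 𝔸} {u : ℂ} {A B P₃ Q₃ : 𝔸}
    (hP : HasDerivAt P (P₁ u) u) (hQ : HasDerivAt Q (Q₁ u) u)
    (hP₁ : HasDerivAt P₁ (P₂ u) u) (hQ₁ : HasDerivAt Q₁ (Q₂ u) u)
    (hP₂ : HasDerivAt P₂ P₃ u) (hQ₂ : HasDerivAt Q₂ Q₃ u)
    (h : ∀ᶠ v in 𝓝 u, P₁ v * Q v - P v * Q₁ v + v • (P₂ v * Q v - P v * Q₂ v)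
      = (P₁ v * Q v + P v * Q₁ v) * A - B * (P₁ v * Q v + P v * Q₁ v)) :
    (P₂ u * Q u - P u * Q₂ u) + (P₂ u * Q u - P u * Q₂ u)
        + u • (P₃ * Q u + P₂ u * Q₁ u - P₁ u * Q₂ u - P u * Q₃)
      = (P₂ u * Q u + (P₁ u * Q₁ u + P₁ u * Q₁ u) + P u * Q₂ u) * A
        - B * (P₂ u * Q u + (P₁ u * Q₁ u + P₁ u * Q₁ u) + P u * Q₂ u) := by
  have l := ((hP₁.mul hQ).sub (hP.mul hQ₁)).add
    ((hasDerivAt_id u).smul ((hP₂.mul hQ).sub (hP.mul hQ₂)))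
  have r := (((hP₁.mul hQ).add (hP.mul hQ₁)).mul_const A).sub
    (((hP₁.mul hQ).add (hP.mul hQ₁)).const_mul B)
  have e := l.unique (r.congr_of_eventuallyEq h)
  simp only [id, Pi.mul_apply, Pi.sub_apply, one_smul] at e
  have h1 : P₃ * Q u + P₂ u * Q₁ u - P₁ u * Q₂ u - P u * Q₃
      = P₃ * Q u + P₂ u * Q₁ u - (P₁ u * Q₂ u + P u * Q₃) := by abel
  have h2 : P₂ u * Q u + (P₁ u * Q₁ u + P₁ u * Q₁ u) + P u * Q₂ u
      = P₂ u * Q u + P₁ u * Q₁ u + (P₁ u * Q₁ u + P u * Q₂ u) := by abel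
  rw [h1, h2, ← e]
  abel

end NormedAlgebra

/-- The second-order terms at the regular point are equal up to squares. -/
theorem second_order_of_sutherland {𝔸 : Type*} [Ring 𝔸] {A B P₂ Q₂ : 𝔸}
    (h : A - B + (P₂ - Q₂) = (A + B) * A - B * (A + B)) :
    P₂ - A * A + A = Q₂ - B * B + B := by
  have : P₂ - Q₂ = (A + B) * A - B * (A + B) - (A - B) := by rw [← h]; abel
  rw [sub_eq_iff_eq_add] at this
  rw [this]
  noncomm_ring

/-- The third-order terms at the regular point give the Reshetikhin condition. -/
theorem third_order_of_sutherland {𝔸 : Type*} [Ring 𝔸] [Algebra ℂ 𝔸]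
    {A B P₂ Q₂ P₃ Q₃ : 𝔸} (c : ℂ)
    (hP₂ : P₂ = A * A - A + c • 1) (hQ₂ : Q₂ = B * B - B + c • 1)
    (h : (P₂ - Q₂) + (P₂ - Q₂) + (P₃ + P₂ * B - A * Q₂ - Q₃)
      = (P₂ + (A * B + A * B) + Q₂) * A - B * (P₂ + (A * B + A * B) + Q₂)) :
    (A * A * A - 3 • (A * A) + 2 • A + 3 • c • A - P₃)
        - (B * B * B - 3 • (B * B) + 2 • B + 3 • c • B - Q₃)
      = ⁅A + B, ⁅A, B⁆⁆ := by
  have h3 : P₃ = (P₂ + (A * B + A * B) + Q₂) * A - B * (P₂ + (A * B + A * B) + Q₂)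
      - ((P₂ - Q₂) + (P₂ - Q₂) + (P₂ * B - A * Q₂)) + Q₃ := by
    rw [← h]; abel
  rw [h3, hP₂, hQ₂]
  simp only [Ring.lie_def, mul_add, add_mul, mul_sub, sub_mul, smul_mul_assoc, mul_smul_comm,
    one_mul, mul_one, mul_assoc]
  abel

/-- The Sutherland equation, obtained from the Yang–Baxter equation by differentiation, for a matrix
function that is analytic around `1` and regular there. -/
structure SolvesSutherland (H : TwoSite) (R : ℂ → TwoSite) : Prop where
  analytic : AnalyticAt ℂ R 1
  regular : R 1 = 1
  sutherland : ∀ᶠ u in 𝓝 (1 : ℂ),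
    u • (onSites12L (deriv R u) * onSites23L (R u) - onSites12L (R u) * onSites23L (deriv R u))
      = onSites12L (R u) * onSites23L (R u) * onSites12L H
        - onSites23L H * onSites12L (R u) * onSites23L (R u)

theorem hasDerivAt_onSites12L {R : ℂ → TwoSite} {R' : TwoSite} {u : ℂ} (h : HasDerivAt R R' u) :
    HasDerivAt (fun v => onSites12L (R v)) (onSites12L R') u :=
  onSites12L.hasFDerivAt.comp_hasDerivAt u h

theorem hasDerivAt_onSites23L {R : ℂ → TwoSite} {R' : TwoSite} {u : ℂ} (h : HasDerivAt R R' u) :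
    HasDerivAt (fun v => onSites23L (R v)) (onSites23L R') u :=
  onSites23L.hasFDerivAt.comp_hasDerivAt u h

namespace IsRegularRMatrixFor

variable {H : TwoSite} {R : ℂ → TwoSite}

theorem analyticAt (h : IsRegularRMatrixFor H R) : AnalyticAt ℂ R 1 :=
  analyticAt_matrix_iff.2 h.analytic

theorem deriv_eq (h : IsRegularRMatrixFor H R) : deriv R 1 = H := by
  ext x y
  exact (h.analyticAt.differentiableAt.hasDerivAt.matrix_apply x y).unique (h.hamiltonian x y)

theorem solvesSutherland (h : IsRegularRMatrixFor H R) : SolvesSutherland H R := by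
  refine ⟨h.analyticAt, h.regular, ?_⟩
  have hyb := h.yangBaxter
  -- Currying the product neighbourhood gives, for each fixed `u` near `1`, the equation for all `v`
  -- near `1`, which can be differentiated in `v`.
  rw [nhds_prod_eq] at hyb
  filter_upwards [hyb.curry, h.analyticAt.eventually_analyticAt] with u hu hau
  have hR : HasDerivAt R H 1 := h.deriv_eq ▸ h.analyticAt.differentiableAt.hasDerivAt
  have hRu := hau.differentiableAt.hasDerivAt
  exact sutherland_of_yangBaxter (P := fun v => onSites12L (R v)) (Q := fun v => onSites23L (R v))
    (by rw [h.regular, onSites12L_one]) (by rw [h.regular, onSites23L_one])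
    (hasDerivAt_onSites12L hR) (hasDerivAt_onSites23L hR)
    (hasDerivAt_onSites12L hRu) (hasDerivAt_onSites23L hRu) hu

end IsRegularRMatrixFor

theorem onSites12L_mul (M N : TwoSite) : onSites12L (M * N) = onSites12L M * onSites12L N := by
  ext ⟨a, b, c⟩ ⟨d, e, f⟩
  simp only [onSites12L_apply, onSites12, Matrix.of_apply, Matrix.mul_apply,
    Fintype.sum_prod_type]
  by_cases hc : c = f
  · subst hc; simp
  · simp [hc]

theorem onSites23L_mul (M N : TwoSite) : onSites23L (M * N) = onSites23L M * onSites23L N := by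
  ext ⟨a, b, c⟩ ⟨d, e, f⟩
  simp only [onSites23L_apply, onSites23, Matrix.of_apply, Matrix.mul_apply,
    Fintype.sum_prod_type]
  by_cases hc : a = d
  · subst hc; simp
  · simp [hc]

/-- The Reshetikhin condition. -/
theorem SolvesSutherland.reshetikhin {H : TwoSite} {R : ℂ → TwoSite} (h : SolvesSutherland H R)
    (hH : deriv R 1 = H) :
    ∃ X : TwoSite, onSites12L X - onSites23L X
      = ⁅onSites12L H + onSites23L H, ⁅onSites12L H, onSites23L H⁆⁆ := by
  have d0 : ∀ᶠ u in 𝓝 (1 : ℂ), HasDerivAt R (deriv R u) u :=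
    h.analytic.eventually_analyticAt.mono fun u hu => hu.differentiableAt.hasDerivAt
  have d1 : ∀ᶠ u in 𝓝 (1 : ℂ), HasDerivAt (deriv R) (deriv (deriv R) u) u :=
    h.analytic.deriv.eventually_analyticAt.mono fun u hu => hu.differentiableAt.hasDerivAt
  have d2 : HasDerivAt (deriv (deriv R)) (deriv (deriv (deriv R)) 1) 1 :=
    h.analytic.deriv.deriv.differentiableAt.hasDerivAt
  have s1 := by
    have := h.sutherland.eventually_nhds.and (d0.and d1)
    exact this.mono fun u hu =>
      sutherland_deriv (hasDerivAt_onSites12L hu.2.1) (hasDerivAt_onSites23L hu.2.1)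
        (hasDerivAt_onSites12L hu.2.2) (hasDerivAt_onSites23L hu.2.2) hu.1
  have c2 := sutherland_deriv_deriv (hasDerivAt_onSites12L d0.self_of_nhds)
    (hasDerivAt_onSites23L d0.self_of_nhds) (hasDerivAt_onSites12L d1.self_of_nhds)
    (hasDerivAt_onSites23L d1.self_of_nhds) (hasDerivAt_onSites12L d2)
    (hasDerivAt_onSites23L d2) s1
  have c1 := s1.self_of_nhds
  simp only [h.regular, hH, onSites12L_one, onSites23L_one, one_mul, mul_one, one_smul] at c1 c2
  set T := deriv (deriv R) 1
  set U := deriv (deriv (deriv R)) 1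
  have hY : onSites12L (T - H * H + H) = onSites23L (T - H * H + H) := by
    rw [map_add, map_sub, map_add, map_sub, onSites12L_mul, onSites23L_mul]
    exact second_order_of_sutherland c1
  -- The undetermined scalar `c` reflects the freedom to rescale `R`; the term `-H` comes from the
  -- factor `u` of the multiplicative parameter.
  obtain ⟨c, hc⟩ : ∃ c : ℂ, T = H * H - H + c • (1 : TwoSite) :=
    ⟨_, by rw [← eq_smul_one_of_onSites12_eq_onSites23 hY]; abel⟩
  have hP := congrArg onSites12L hc
  have hQ := congrArg onSites23L hc
  rw [map_add, map_sub, map_smul, onSites12L_mul, onSites12L_one] at hP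
  rw [map_add, map_sub, map_smul, onSites23L_mul, onSites23L_one] at hQ
  -- After substitution of the second derivative, `X` collects the third-order terms supported on a
  -- single pair of sites; the mixed ones form the double commutator.
  refine ⟨H * H * H - 3 • (H * H) + 2 • H + 3 • c • H - U, ?_⟩
  simp only [map_sub, map_add, map_nsmul, map_smul, onSites12L_mul, onSites23L_mul]
  exact third_order_of_sutherland c hP hQ c2

/-! ### Uniqueness of the `R`-matrix up to a scalar function. -/

theorem AnalyticAt.exists_eventuallyEq_sub_smul {E : Type*} [NormedAddCommGroup E]
    [NormedSpace ℂ E] {f : ℂ → E} {z : ℂ} (hf : AnalyticAt ℂ f z) (h0 : f z = 0) :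
    ∃ g : ℂ → E, AnalyticAt ℂ g z ∧ ∀ᶠ u in 𝓝 z, f u = (u - z) • g u := by
  have h := (natCast_le_analyticOrderAt hf (n := 1)).1
    (by simpa [Order.one_le_iff_ne_zero] using hf.analyticOrderAt_ne_zero.2 h0)
  simpa using h

theorem AnalyticAt.eventually_eq_zero_of_forall_pow {E : Type*} [NormedAddCommGroup E]
    [NormedSpace ℂ E] {f : ℂ → E} {z : ℂ} (hf : AnalyticAt ℂ f z)
    (h : ∀ n : ℕ, ∃ g : ℂ → E, AnalyticAt ℂ g z ∧ ∀ᶠ u in 𝓝 z, f u = (u - z) ^ n • g u) :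
    ∀ᶠ u in 𝓝 z, f u = 0 :=
  analyticOrderAt_eq_top.1 <| ENat.eq_top_iff_forall_ge.2 fun n =>
    (natCast_le_analyticOrderAt hf).2 (h n)

theorem ContinuousAt.eq_zero_of_eventually_pow_smul_eq_zero {E : Type*} [NormedAddCommGroup E]
    [NormedSpace ℂ E] {f : ℂ → E} {z : ℂ} (hf : ContinuousAt f z) {n : ℕ}
    (h : ∀ᶠ u in 𝓝 z, (u - z) ^ n • f u = 0) : f z = 0 := by
  have h1 : ∀ᶠ u in 𝓝[≠] z, f u = 0 := by
    filter_upwards [h.filter_mono nhdsWithin_le_nhds, self_mem_nhdsWithin] with u hu hz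
    exact (smul_eq_zero.1 hu).resolve_left (pow_ne_zero _ (sub_ne_zero.2 hz))
  exact tendsto_nhds_unique (hf.tendsto.mono_left nhdsWithin_le_nhds)
    (tendsto_const_nhds.congr' (h1.mono fun _ hu => hu.symm))

theorem deriv_eq_of_eventuallyEq_add_pow_smul {E : Type*} [NormedAddCommGroup E]
    [NormedSpace ℂ E] {R S G : ℂ → E} {u z : ℂ} {m : ℕ} (hR : DifferentiableAt ℂ R u)
    (hG : DifferentiableAt ℂ G u) (h : ∀ᶠ v in 𝓝 u, S v = R v + (v - z) ^ (m + 1) • G v) :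
    deriv S u = deriv R u + (u - z) ^ m • ((m + 1 : ℂ) • G u + (u - z) • deriv G u) := by
  have hp := ((hasDerivAt_id u).sub_const z).fun_pow (m + 1)
  have hd := hR.hasDerivAt.add (hp.smul hG.hasDerivAt)
  rw [(hd.congr_of_eventuallyEq h).deriv]
  simp only [id, add_tsub_cancel_right, Nat.cast_add, Nat.cast_one]
  module

section NormedAlgebra

variable {𝔸 : Type*} [NormedRing 𝔸] [NormedAlgebra ℂ 𝔸]

/-- The leading terms of the difference of two solutions of the Sutherland equation. -/
theorem leading_term_of_sutherland {P Q PG QG P' Q' PG' QG' S T S' T' : ℂ → 𝔸} {A B : 𝔸} {m : ℕ}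
    (cP : ContinuousAt P 1) (cPG : ContinuousAt PG 1) (cQG : ContinuousAt QG 1)
    (cP' : ContinuousAt P' 1) (cPG' : ContinuousAt PG' 1) (cQG' : ContinuousAt QG' 1)
    (cT : ContinuousAt T 1) (cT' : ContinuousAt T' 1)
    (hP : P 1 = 1) (hT : T 1 = 1)
    (hR : ∀ᶠ u in 𝓝 (1 : ℂ), u • (P' u * Q u - P u * Q' u) = P u * Q u * A - B * P u * Q u)
    (hS : ∀ᶠ u in 𝓝 (1 : ℂ), u • (S' u * T u - S u * T' u) = S u * T u * A - B * S u * T u)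
    (eS : ∀ᶠ u in 𝓝 (1 : ℂ), S u = P u + (u - 1) ^ (m + 1) • PG u)
    (eT : ∀ᶠ u in 𝓝 (1 : ℂ), T u = Q u + (u - 1) ^ (m + 1) • QG u)
    (eS' : ∀ᶠ u in 𝓝 (1 : ℂ),
      S' u = P' u + (u - 1) ^ m • ((m + 1 : ℂ) • PG u + (u - 1) • PG' u))
    (eT' : ∀ᶠ u in 𝓝 (1 : ℂ),
      T' u = Q' u + (u - 1) ^ m • ((m + 1 : ℂ) • QG u + (u - 1) • QG' u)) :
    PG 1 = QG 1 := by
  -- `(u - 1) ^ m • K u` is the difference of the two Sutherland equations. Only the differentiated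
  -- terms survive in `K 1`, which equals `(m + 1) • (PG 1 - QG 1)`.
  let K : ℂ → 𝔸 := fun u =>
    u • (((m + 1 : ℂ) • PG u + (u - 1) • PG' u) * T u + (u - 1) • (P' u * QG u)
        - ((u - 1) • (PG u * T' u) + P u * ((m + 1 : ℂ) • QG u + (u - 1) • QG' u)))
      - (u - 1) • ((PG u * T u + P u * QG u) * A - B * (PG u * T u + P u * QG u))
  have hK : K 1 = 0 := by
    refine ContinuousAt.eq_zero_of_eventually_pow_smul_eq_zero (n := m) ?_ ?_
    · simp only [K]
      fun_prop
    · filter_upwards [hR, hS, eS, eT, eS', eT'] with u hR hS eS eT eS' eT'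
      have e1 : P' u * Q u = P' u * T u - (u - 1) ^ (m + 1) • (P' u * QG u) := by
        rw [eT, mul_add, mul_smul_comm]; abel
      have e2 : P u * Q' u = P u * T' u
          - (u - 1) ^ m • (P u * ((m + 1 : ℂ) • QG u + (u - 1) • QG' u)) := by
        rw [eT', mul_add, mul_smul_comm]; abel
      have e3 : P u * Q u = P u * T u - (u - 1) ^ (m + 1) • (P u * QG u) := by
        rw [eT, mul_add, mul_smul_comm]; abel
      rw [mul_assoc B, e1, e2, e3] at hR
      rw [mul_assoc B, eS, eS'] at hS
      have hd := congrArg₂ (· - ·) hS hR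
      simp only [add_mul, sub_mul, mul_add, mul_sub, smul_mul_assoc, mul_smul_comm] at hd
      rw [← sub_eq_zero] at hd
      rw [← hd]
      simp only [K, add_mul, mul_add, smul_mul_assoc, mul_smul_comm, mul_assoc]
      module
  have hm : (m + 1 : ℂ) ≠ 0 := by exact_mod_cast Nat.succ_ne_zero m
  simp only [K, sub_self, zero_smul, add_zero, one_smul, hP, hT, one_mul, mul_one, sub_zero,
    zero_add, ← smul_sub] at hK
  exact sub_eq_zero.1 ((smul_eq_zero.1 hK).resolve_left hm)

end NormedAlgebra

namespace SolvesSutherland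

variable {H : TwoSite} {R S : ℂ → TwoSite}

/-- A solution of the Sutherland equation is determined by one of its diagonal entries. -/
theorem eventually_eq (hR : SolvesSutherland H R) (hS : SolvesSutherland H S)
    (h00 : ∀ᶠ u in 𝓝 (1 : ℂ), R u (0, 0) (0, 0) = S u (0, 0) (0, 0)) :
    ∀ᶠ u in 𝓝 (1 : ℂ), S u = R u := by
  have hE : AnalyticAt ℂ (fun u => S u - R u) 1 := hS.analytic.sub hR.analytic
  -- The difference vanishes to every order. Regularity gives order one, hence the exponent `n + 1`,
  -- which also makes the factor produced by differentiation nonzero.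
  suffices h : ∀ n : ℕ, ∃ G : ℂ → TwoSite, AnalyticAt ℂ G 1 ∧
      ∀ᶠ u in 𝓝 (1 : ℂ), S u - R u = (u - 1) ^ (n + 1) • G u by
    refine (hE.eventually_eq_zero_of_forall_pow fun n => ?_).mono fun u hu => sub_eq_zero.1 hu
    obtain ⟨G, hG, h⟩ := h n
    refine ⟨fun u => (u - 1) • G u, (analyticAt_id.sub analyticAt_const).smul hG,
      h.mono fun u hu => ?_⟩
    rw [hu, pow_succ, mul_smul]
  intro m
  induction m with
  | zero =>
    simpa using hE.exists_eventuallyEq_sub_smul (by simp [hR.regular, hS.regular])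
  | succ m ih =>
    obtain ⟨G, hG, h⟩ := ih
    suffices hG0 : G 1 = 0 by
      obtain ⟨G', hG', h'⟩ := hG.exists_eventuallyEq_sub_smul hG0
      refine ⟨G', hG', ?_⟩
      filter_upwards [h, h'] with u hu hu'
      rw [hu, hu', smul_smul, ← pow_succ]
    have hSR : ∀ᶠ u in 𝓝 (1 : ℂ), S u = R u + (u - 1) ^ (m + 1) • G u :=
      h.mono fun u hu => by rw [← hu]; abel
    have hSR' : ∀ᶠ u in 𝓝 (1 : ℂ),
        deriv S u = deriv R u + (u - 1) ^ m • ((m + 1 : ℂ) • G u + (u - 1) • deriv G u) := by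
      filter_upwards [hSR.eventually_nhds, hR.analytic.eventually_analyticAt,
        hG.eventually_analyticAt] with u hu hRu hGu
      exact deriv_eq_of_eventuallyEq_add_pow_smul hRu.differentiableAt hGu.differentiableAt hu
    have hlead : onSites12L (G 1) = onSites23L (G 1) := by
      have c12 : ∀ {F : ℂ → TwoSite}, AnalyticAt ℂ F 1 →
          ContinuousAt (fun u => onSites12L (F u)) 1 := fun hF =>
        onSites12L.continuous.continuousAt.comp hF.continuousAt
      have c23 : ∀ {F : ℂ → TwoSite}, AnalyticAt ℂ F 1 →
          ContinuousAt (fun u => onSites23L (F u)) 1 := fun hF =>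
        onSites23L.continuous.continuousAt.comp hF.continuousAt
      refine leading_term_of_sutherland (m := m) (c12 hR.analytic) (c12 hG) (c23 hG)
        (c12 hR.analytic.deriv) (c12 hG.deriv) (c23 hG.deriv)
        (c23 hS.analytic) (c23 hS.analytic.deriv)
        (by simp only [hR.regular, onSites12L_one]) (by simp only [hS.regular, onSites23L_one])
        hR.sutherland hS.sutherland
        (hSR.mono fun u hu => by rw [hu, map_add, map_smul])
        (hSR.mono fun u hu => by rw [hu, map_add, map_smul])
        (hSR'.mono fun u hu => (congrArg onSites12L hu).trans (by simp only [map_add, map_smul]; rfl))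
        (hSR'.mono fun u hu => (congrArg onSites23L hu).trans (by simp only [map_add, map_smul]; rfl))
    have hG00 : G 1 (0, 0) (0, 0) = 0 := by
      refine ContinuousAt.eq_zero_of_eventually_pow_smul_eq_zero (n := m + 1)
        (f := fun u => G u (0, 0) (0, 0))
        (analyticAt_matrix_iff.1 hG (0, 0) (0, 0)).continuousAt ?_
      filter_upwards [hSR, h00] with u hu hu0
      rw [hu] at hu0
      simpa using hu0
    -- The leading coefficient is scalar, and the common diagonal entry forces that scalar to
    -- vanish.
    rw [eq_smul_one_of_onSites12_eq_onSites23 hlead, hG00, zero_smul]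

/-- The Sutherland equation is homogeneous. -/
theorem smul (h : SolvesSutherland H R) {f : ℂ → ℂ} (hf : AnalyticAt ℂ f 1) (h1 : f 1 = 1) :
    SolvesSutherland H (fun u => f u • R u) := by
  refine ⟨hf.smul h.analytic, by rw [h1, h.regular, one_smul], ?_⟩
  filter_upwards [h.sutherland, h.analytic.eventually_analyticAt,
    hf.eventually_analyticAt] with u hu hRu hfu
  have hd : deriv (fun u => f u • R u) u = f u • deriv R u + deriv f u • R u :=
    (hfu.differentiableAt.hasDerivAt.smul hRu.differentiableAt.hasDerivAt).deriv
  have e := congrArg (fun M => (f u * f u) • M) hu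
  rw [hd]
  simp only [map_add, map_smul, add_mul, mul_add, smul_mul_assoc, mul_smul_comm, smul_sub] at e ⊢
  rw [← sub_eq_zero] at e ⊢
  rw [← e]
  module

end SolvesSutherland

/-- Two regular `R`-matrices of the same Hamiltonian are proportional. -/
theorem IsRegularRMatrixFor.eventually_proportional {H : TwoSite} {R S : ℂ → TwoSite}
    (hR : IsRegularRMatrixFor H R) (hS : IsRegularRMatrixFor H S) :
    ∀ᶠ u in 𝓝 (1 : ℂ), R u (0, 0) (0, 0) • S u = S u (0, 0) (0, 0) • R u := by
  -- Each solution is multiplied by the other's entry at `|00⟩`, so that these entries agree.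
  -- Rescaling may change the derivative at `1`, which `SolvesSutherland` leaves free.
  have h1 := hR.solvesSutherland.smul (hS.analytic (0, 0) (0, 0)) (by simp [hS.regular])
  have h2 := hS.solvesSutherland.smul (hR.analytic (0, 0) (0, 0)) (by simp [hR.regular])
  exact h1.eventually_eq h2 (Eventually.of_forall fun u => by simp [mul_comm])

/-! ### Obstructions from the Reshetikhin condition. -/

/-- The Hamiltonian of the generalized SpR model with all its shifts. -/
noncomputable def shiftedSpRHamiltonian (θ₀ τ₃ κ α β : ℂ) (a : Fin 3 → ℂ) : TwoSite :=
  spRHamiltonian θ₀ τ₃ κ + α • (1 : TwoSite) + β • twoSiteSpin + telescopic a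

/-- The entries of the Hamiltonian of the generalized SpR model with all its shifts. -/
noncomputable def spREntry (θ₀ τ₃ κ α β : ℂ) (a : Fin 3 → ℂ) (i j k l : Fin 3) : ℂ :=
  if i = k ∧ j = l then
    (![![(τ₃ ^ 2 - τ₃ + 1 + θ₀) / 4, 0, (τ₃ ^ 2 - τ₃ + 1 + θ₀) / 4],
       ![0, -((τ₃ ^ 2 - τ₃ + 1 + θ₀) / 4), 0],
       ![(τ₃ ^ 2 - τ₃ + 1 + θ₀) / 4, 0, (τ₃ ^ 2 - τ₃ + 1 + θ₀) / 4]] : Fin 3 → Fin 3 → ℂ) i j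
      + α + β * ((i : ℕ) + (j : ℕ)) + (a i - a j)
  else match i, j, k, l with
    | 0, 1, 1, 0 => 1
    | 1, 0, 0, 1 => θ₀
    | 2, 0, 1, 1 => κ
    | 1, 1, 2, 0 => θ₀ * τ₃ / κ
    | 0, 2, 1, 1 => κ / θ₀
    | 1, 1, 0, 2 => θ₀ ^ 2 * τ₃ / κ
    | 1, 2, 2, 1 => τ₃
    | 2, 1, 1, 2 => θ₀ * τ₃
    | 0, 2, 2, 0 => 1
    | 2, 0, 0, 2 => θ₀ * (τ₃ ^ 2 - τ₃ + 1)
    | _, _, _, _ => 0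

set_option maxHeartbeats 2000000 in
theorem shiftedSpRHamiltonian_apply (θ₀ τ₃ κ α β : ℂ) (a : Fin 3 → ℂ) (i j k l : Fin 3) :
    shiftedSpRHamiltonian θ₀ τ₃ κ α β a (i, j) (k, l) = spREntry θ₀ τ₃ κ α β a i j k l := by
  simp only [shiftedSpRHamiltonian, spRHamiltonian, vertexHamiltonian, elemE, twoSiteSpin, spinZ,
    telescopic, Matrix.add_apply, Matrix.sub_apply, Matrix.smul_apply,
    Matrix.kroneckerMap_apply, Matrix.single_apply, Fin.sum_univ_three, Matrix.one_apply,
    Matrix.diagonal_apply, Prod.mk.injEq, smul_eq_mul]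
  fin_cases i <;> fin_cases j <;> fin_cases k <;> fin_cases l <;> simp [spREntry]

theorem onSites12_mul_apply (M : TwoSite) (N : ThreeSite) (i j c : Fin 3)
    (y : Fin 3 × Fin 3 × Fin 3) :
    (onSites12 M * N) (i, j, c) y = ∑ k, ∑ l, M (i, j) (k, l) * N (k, l, c) y := by
  simp [Matrix.mul_apply, Fintype.sum_prod_type, onSites12]

theorem onSites23_mul_apply (M : TwoSite) (N : ThreeSite) (c i j : Fin 3)
    (y : Fin 3 × Fin 3 × Fin 3) :
    (onSites23 M * N) (c, i, j) y = ∑ k, ∑ l, M (i, j) (k, l) * N (c, k, l) y := by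
  simp [Matrix.mul_apply, Fintype.sum_prod_type, onSites23]

/-- Products are nested to the right so that an entry can be computed by peeling off one left factor
at a time. -/
theorem reshetikhin_expand {𝔸 : Type*} [Ring 𝔸] (A B : 𝔸) :
    ⁅A + B, ⁅A, B⁆⁆ = A * (A * B) - A * (B * A) - A * (B * A) + B * (A * A)
      + B * (A * B) + B * (A * B) - B * (B * A) - A * (B * B) := by
  simp only [Ring.lie_def]
  noncomm_ring

/-- `X₁₂` preserves the third site and `X₂₃` the first, so the unknown `X` drops out of entries that
change both. -/
theorem reshetikhin_apply_eq_zero {H : TwoSite} {R : ℂ → TwoSite} (h : IsRegularRMatrixFor H R)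
    {x y : Fin 3 × Fin 3 × Fin 3} (h1 : x.1 ≠ y.1) (h3 : x.2.2 ≠ y.2.2) :
    ⁅onSites12 H + onSites23 H, ⁅onSites12 H, onSites23 H⁆⁆ x y = 0 := by
  obtain ⟨X, hX⟩ := h.solvesSutherland.reshetikhin h.deriv_eq
  rw [← onSites12L_apply, ← onSites23L_apply, ← hX]
  simp [onSites12L_apply, onSites23L_apply, onSites12, onSites23, h1, h3]

-- The chosen entry equals `2τ₃(2a₁ - a₀ - a₂)`. The conclusion says that `A` is a combination of
-- the identity and `𝔰ᶻ`.
set_option maxHeartbeats 2000000 in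
theorem shift_of_isRegularRMatrixFor {θ₀ τ₃ κ α β : ℂ} {a : Fin 3 → ℂ} {R : ℂ → TwoSite}
    (hθ : θ₀ ≠ 0) (hτ : τ₃ ≠ 0) (hκ : κ ≠ 0)
    (h : IsRegularRMatrixFor (shiftedSpRHamiltonian θ₀ τ₃ κ α β a) R) :
    2 * a 1 = a 0 + a 2 := by
  have e := reshetikhin_apply_eq_zero h (x := (0, 1, 1)) (y := (1, 1, 0)) (by decide) (by decide)
  rw [reshetikhin_expand] at e
  simp only [Matrix.add_apply, Matrix.sub_apply, onSites12_mul_apply, onSites23_mul_apply,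
    Fin.sum_univ_three, shiftedSpRHamiltonian_apply] at e
  simp [onSites12, onSites23, shiftedSpRHamiltonian_apply, spREntry] at e
  have key : 2 * τ₃ * (2 * a 1 - a 0 - a 2) = 0 := by
    rw [← e]
    field_simp
    ring
  linear_combination (mul_eq_zero.1 key).resolve_left (mul_ne_zero two_ne_zero hτ)

-- Up to a nonzero factor, the chosen entry is `θ₀ - δ₀` plus a multiple of `2a₁ - a₀ - a₂`. Neither
-- `α` nor `β` enters, so no shift can remove this obstruction.
set_option maxHeartbeats 2000000 in
theorem spR_theta_eq {θ₀ τ₃ κ α β : ℂ} {a : Fin 3 → ℂ} {R : ℂ → TwoSite}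
    (hθ : θ₀ ≠ 0) (hτ : τ₃ ≠ 0) (hκ : κ ≠ 0)
    (h : IsRegularRMatrixFor (shiftedSpRHamiltonian θ₀ τ₃ κ α β a) R) :
    θ₀ = τ₃ ^ 2 - τ₃ + 1 := by
  have e := reshetikhin_apply_eq_zero h (x := (1, 0, 1)) (y := (0, 2, 0)) (by decide) (by decide)
  rw [reshetikhin_expand] at e
  simp only [Matrix.add_apply, Matrix.sub_apply, onSites12_mul_apply, onSites23_mul_apply,
    Fin.sum_univ_three, shiftedSpRHamiltonian_apply] at e
  simp [onSites12, onSites23, shiftedSpRHamiltonian_apply, spREntry] at e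
  have key : (-(θ₀ ^ 2 * τ₃ / κ)) * (θ₀ - τ₃ ^ 2 + τ₃ - 1 + 2 * (2 * a 1 - a 0 - a 2)) = 0 := by
    rw [← e]
    field_simp
    ring
  have hc : -(θ₀ ^ 2 * τ₃ / κ) ≠ 0 :=
    neg_ne_zero.2 (div_ne_zero (mul_ne_zero (pow_ne_zero _ hθ) hτ) hκ)
  linear_combination (mul_eq_zero.1 key).resolve_left hc
    - 2 * shift_of_isRegularRMatrixFor hθ hτ hκ h

-- Here the spin shift does enter: the constraint becomes `τ₃² = 1` exactly when `β = 0`.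
set_option maxHeartbeats 2000000 in
theorem spR_tau_sq {θ₀ τ₃ κ α β : ℂ} {a : Fin 3 → ℂ} {R : ℂ → TwoSite}
    (hθ : θ₀ ≠ 0) (hτ : τ₃ ≠ 0) (hκ : κ ≠ 0)
    (h : IsRegularRMatrixFor (shiftedSpRHamiltonian θ₀ τ₃ κ α β a) R) :
    τ₃ ^ 2 = 1 + 2 * β := by
  have e := reshetikhin_apply_eq_zero h (x := (0, 1, 1)) (y := (2, 0, 0)) (by decide) (by decide)
  rw [reshetikhin_expand] at e
  simp only [Matrix.add_apply, Matrix.sub_apply, onSites12_mul_apply, onSites23_mul_apply,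
    Fin.sum_univ_three, shiftedSpRHamiltonian_apply] at e
  simp [onSites12, onSites23, shiftedSpRHamiltonian_apply, spREntry] at e
  have key : (θ₀ * τ₃ / κ) * (τ₃ ^ 2 - 1 - 2 * β + (2 * a 1 - a 0 - a 2)) = 0 := by
    rw [← e]
    field_simp
    ring
  have hc : θ₀ * τ₃ / κ ≠ 0 := div_ne_zero (mul_ne_zero hθ hτ) hκ
  linear_combination (mul_eq_zero.1 key).resolve_left hc
    - shift_of_isRegularRMatrixFor hθ hτ hκ h

/-! ### Symmetries of the Hamiltonian inherited by the `R`-matrix. -/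

/-- The conjugation of a matrix by the weighted permutation matrix with permutation `σ` and
weights `w`. -/
def weightedReindex {n : Type*} (σ : Equiv.Perm n) (w : n → ℂˣ) (M : Matrix n n ℂ) :
    Matrix n n ℂ :=
  Matrix.of fun x y => w x * M (σ x) (σ y) * (w y)⁻¹

theorem weightedReindex_apply {n : Type*} (σ : Equiv.Perm n) (w : n → ℂˣ) (M : Matrix n n ℂ)
    (x y : n) : weightedReindex σ w M x y = w x * M (σ x) (σ y) * ((w y)⁻¹ : ℂˣ) := by
  simp [weightedReindex]

theorem weightedReindex_mul {n : Type*} [Fintype n] (σ : Equiv.Perm n) (w : n → ℂˣ)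
    (M N : Matrix n n ℂ) :
    weightedReindex σ w (M * N) = weightedReindex σ w M * weightedReindex σ w N := by
  ext x y
  simp only [weightedReindex_apply, Matrix.mul_apply]
  rw [← Equiv.sum_comp σ, Finset.mul_sum, Finset.sum_mul]
  refine Finset.sum_congr rfl fun z _ => ?_
  linear_combination (-(w x : ℂ) * M (σ x) (σ z) * N (σ z) (σ y) * ((w y)⁻¹ : ℂˣ))
    * (w z).inv_mul

theorem weightedReindex_one {n : Type*} [DecidableEq n] (σ : Equiv.Perm n) (w : n → ℂˣ) :
    weightedReindex σ w (1 : Matrix n n ℂ) = 1 := by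
  ext x y
  rw [weightedReindex_apply]
  by_cases h : x = y
  · subst h; simp
  · simp [h]

/-- Transport of a regular `R`-matrix along a weighted permutation of the basis that preserves the
Yang–Baxter equation. -/
theorem isRegularRMatrixFor_weightedReindex {H : TwoSite} {R : ℂ → TwoSite}
    (h : IsRegularRMatrixFor H R) (σ : Equiv.Perm (Fin 3 × Fin 3)) (w : Fin 3 × Fin 3 → ℂˣ)
    (hyb : ∀ᶠ p : ℂ × ℂ in 𝓝 (1, 1),
      onSites12 (weightedReindex σ w (R p.1)) * onSites23 (weightedReindex σ w (R (p.1 * p.2)))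
          * onSites12 (weightedReindex σ w (R p.2))
        = onSites23 (weightedReindex σ w (R p.2)) * onSites12 (weightedReindex σ w (R (p.1 * p.2)))
          * onSites23 (weightedReindex σ w (R p.1))) :
    IsRegularRMatrixFor (weightedReindex σ w H) fun u => weightedReindex σ w (R u) where
  analytic x y := by
    simp only [weightedReindex_apply]
    exact (analyticAt_const.mul (h.analytic _ _)).mul analyticAt_const
  regular := by rw [h.regular, weightedReindex_one]
  hamiltonian x y := by
    simp only [weightedReindex_apply]
    exact ((h.hamiltonian _ _).const_mul _).mul_const _
  yangBaxter := hyb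

theorem eventually_three {p : ℂ → Prop} (h : ∀ᶠ u in 𝓝 (1 : ℂ), p u) :
    ∀ᶠ w : ℂ × ℂ in 𝓝 (1, 1), p w.1 ∧ p w.2 ∧ p (w.1 * w.2) := by
  have h1 : Tendsto (fun w : ℂ × ℂ => w.1) (𝓝 (1, 1)) (𝓝 1) := continuous_fst.tendsto' _ _ rfl
  have h2 : Tendsto (fun w : ℂ × ℂ => w.2) (𝓝 (1, 1)) (𝓝 1) := continuous_snd.tendsto' _ _ rfl
  have h3 : Tendsto (fun w : ℂ × ℂ => w.1 * w.2) (𝓝 (1, 1)) (𝓝 1) :=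
    continuous_mul.tendsto' _ _ (by simp)
  exact (h1.eventually h).and ((h2.eventually h).and (h3.eventually h))

/-- The regular `R`-matrix of a Hamiltonian that commutes with `g ⊗ g`, for a diagonal `g`, commutes
with `g ⊗ g`. -/
theorem IsRegularRMatrixFor.eventually_commute {H : TwoSite} {R : ℂ → TwoSite}
    (h : IsRegularRMatrixFor H R) (g : Fin 3 → ℂˣ)
    (hH : weightedReindex 1 (fun x => g x.1 * g x.2) H = H) :
    ∀ᶠ u in 𝓝 (1 : ℂ), weightedReindex 1 (fun x => g x.1 * g x.2) (R u) = R u := by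
  -- Conjugation by `g ⊗ g ⊗ g` restricts to `g ⊗ g` on either pair, because the weight of the
  -- spectator site cancels.
  let W : Fin 3 × Fin 3 × Fin 3 → ℂˣ := fun x => g x.1 * g x.2.1 * g x.2.2
  have h12 : ∀ M, onSites12 (weightedReindex 1 (fun x => g x.1 * g x.2) M)
      = weightedReindex 1 W (onSites12 M) := by
    intro M
    ext x y
    simp only [onSites12, Matrix.of_apply, weightedReindex_apply, W, Equiv.Perm.one_apply]
    split_ifs with hc
    · rw [hc]; push_cast; field_simp
    · simp
  have h23 : ∀ M, onSites23 (weightedReindex 1 (fun x => g x.1 * g x.2) M)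
      = weightedReindex 1 W (onSites23 M) := by
    intro M
    ext x y
    simp only [onSites23, Matrix.of_apply, weightedReindex_apply, W, Equiv.Perm.one_apply]
    split_ifs with hc
    · rw [hc]; push_cast; field_simp
    · simp
  have hS := isRegularRMatrixFor_weightedReindex h 1 (fun x => g x.1 * g x.2) (h.yangBaxter.mono fun p hp => by
    simp only [h12, h23, ← weightedReindex_mul, hp])
  rw [hH] at hS
  have h0 : ∀ᶠ u in 𝓝 (1 : ℂ), R u (0, 0) (0, 0) ≠ 0 :=
    (h.analytic (0, 0) (0, 0)).continuousAt.eventually_ne (by simp [h.regular])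
  filter_upwards [h.eventually_proportional hS, h0] with u hu hu0
  -- Diagonal conjugation fixes diagonal entries, so the proportionality factor is `1`.
  have e : weightedReindex 1 (fun x => g x.1 * g x.2) (R u) (0, 0) (0, 0) = R u (0, 0) (0, 0) := by
    rw [weightedReindex_apply, mul_right_comm, Units.mul_inv, one_mul]; rfl
  rw [e] at hu
  exact smul_right_injective _ hu0 hu

/-- The exchange `|i⟩ ⊗ |j⟩ ↦ |2 - j⟩ ⊗ |2 - i⟩`. -/
def revSwap : Equiv.Perm (Fin 3 × Fin 3) :=
  (Equiv.prodComm _ _).trans (Equiv.prodCongr Fin.revPerm Fin.revPerm)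

/-- The exchange `|i⟩ ⊗ |j⟩ ⊗ |k⟩ ↦ |2 - k⟩ ⊗ |2 - j⟩ ⊗ |2 - i⟩`. -/
def revReverse : Equiv.Perm (Fin 3 × Fin 3 × Fin 3) where
  toFun x := (x.2.2.rev, x.2.1.rev, x.1.rev)
  invFun x := (x.2.2.rev, x.2.1.rev, x.1.rev)
  left_inv x := by simp
  right_inv x := by simp

/-- Charge conjugation, combined with the exchange of the sites and with the twist by the diagonal
matrix `c`, preserves the Yang–Baxter equation for matrices commuting with `c² ⊗ c²`, `c⁴ = 1`. -/
theorem isRegularRMatrixFor_revSwap {H : TwoSite} {R : ℂ → TwoSite}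
    (h : IsRegularRMatrixFor H R) (c : Fin 3 → ℂˣ) (hc : ∀ i, c i ^ 4 = 1)
    (hrev : ∀ i, c i.rev = c i)
    (hR : ∀ᶠ u in 𝓝 (1 : ℂ),
      weightedReindex 1 (fun x => c x.1 ^ 2 * c x.2 ^ 2) (R u) = R u) :
    IsRegularRMatrixFor (weightedReindex revSwap (fun x => c x.1 * (c x.2)⁻¹) H)
      fun u => weightedReindex revSwap (fun x => c x.1 * (c x.2)⁻¹) (R u) := by
  -- Alternating weights match the twist `c ⊗ c⁻¹` on sites 1, 2 but give `c⁻¹ ⊗ c` on sites 2, 3.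
  -- The two differ by `c² ⊗ c⁻² = c² ⊗ c²`, since `c⁴ = 1`, and `R` commutes with this.
  let W : Fin 3 × Fin 3 × Fin 3 → ℂˣ := fun x => c x.1 * (c x.2.1)⁻¹ * c x.2.2
  have h12 : ∀ M, onSites12 (weightedReindex revSwap (fun x => c x.1 * (c x.2)⁻¹) M)
      = weightedReindex revReverse W (onSites23 M) := by
    intro M
    ext x y
    simp only [onSites12, onSites23, Matrix.of_apply, weightedReindex_apply, W, revReverse,
      revSwap, Equiv.coe_fn_mk, Equiv.trans_apply, Equiv.prodComm_apply,
      Equiv.prodCongr_apply, Prod.map, Prod.swap, Fin.revPerm_apply, Fin.rev_inj]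
    split_ifs with he
    · rw [he]; push_cast; field_simp
    · simp
  have h23 : ∀ M, weightedReindex 1 (fun x => c x.1 ^ 2 * c x.2 ^ 2) M = M →
      onSites23 (weightedReindex revSwap (fun x => c x.1 * (c x.2)⁻¹) M)
      = weightedReindex revReverse W (onSites12 M) := by
    intro M hM
    ext x y
    simp only [onSites12, onSites23, Matrix.of_apply, weightedReindex_apply, W, revReverse,
      revSwap, Equiv.coe_fn_mk, Equiv.trans_apply, Equiv.prodComm_apply,
      Equiv.prodCongr_apply, Prod.map, Prod.swap, Fin.revPerm_apply, Fin.rev_inj]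
    split_ifs with he
    · rw [he]
      have e := congrFun (congrFun hM (x.2.2.rev, x.2.1.rev)) (y.2.2.rev, y.2.1.rev)
      simp only [weightedReindex_apply, Equiv.Perm.one_apply, hrev] at e
      have hc' : ∀ i, (c i : ℂ) ^ 4 = 1 := fun i => by
        simpa using congrArg Units.val (hc i)
      push_cast at e ⊢
      field_simp at e ⊢
      linear_combination (c x.2.2 : ℂ) ^ 2 * (c y.2.2 : ℂ) ^ 2 * e
        + (c y.2.1 : ℂ) ^ 2 * (c x.2.2 : ℂ) ^ 2 * M (x.2.2.rev, x.2.1.rev) (y.2.2.rev, y.2.1.rev)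
          * hc' y.2.2
        - (c x.2.1 : ℂ) ^ 2 * (c y.2.2 : ℂ) ^ 2 * M (x.2.2.rev, x.2.1.rev) (y.2.2.rev, y.2.1.rev)
          * hc' x.2.2
    · simp
  refine isRegularRMatrixFor_weightedReindex h _ _ ?_
  -- Reversing the three sites exchanges the roles of the pairs 12 and 23; exchanging `u` and `v`
  -- restores the form of the equation.
  have hsw : Tendsto Prod.swap (𝓝 ((1 : ℂ), (1 : ℂ))) (𝓝 (1, 1)) :=
    continuous_swap.tendsto' _ _ rfl
  filter_upwards [eventually_three hR, hsw.eventually h.yangBaxter] with p hp hyb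
  simp only [Prod.fst_swap, Prod.snd_swap] at hyb
  rw [mul_comm p.2] at hyb
  rw [h12, h12, h12, h23 _ hp.1, h23 _ hp.2.1, h23 _ hp.2.2]
  simp only [← weightedReindex_mul]
  rw [hyb]

/-- The diagonal entries at `|00⟩` and `|22⟩` agree when the Hamiltonian is invariant under charge
conjugation combined with the exchange of the sites and with a twist. -/
theorem IsRegularRMatrixFor.eventually_eq_of_revSwap {H : TwoSite} {R : ℂ → TwoSite}
    (h : IsRegularRMatrixFor H R) (c : Fin 3 → ℂˣ) (hc : ∀ i, c i ^ 4 = 1)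
    (hrev : ∀ i, c i.rev = c i)
    (hH : weightedReindex 1 (fun x => c x.1 ^ 2 * c x.2 ^ 2) H = H)
    (hH' : weightedReindex revSwap (fun x => c x.1 * (c x.2)⁻¹) H = H) :
    ∀ᶠ u in 𝓝 (1 : ℂ), R u (0, 0) (0, 0) = R u (2, 2) (2, 2) := by
  have hS := isRegularRMatrixFor_revSwap h c hc hrev
    (h.eventually_commute (fun i => c i ^ 2) hH)
  rw [hH'] at hS
  have hne : ∀ᶠ u in 𝓝 (1 : ℂ), R u (0, 0) (0, 0) + R u (2, 2) (2, 2) ≠ 0 :=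
    ((h.analytic (0, 0) (0, 0)).continuousAt.add
      (h.analytic (2, 2) (2, 2)).continuousAt).eventually_ne (by simp [h.regular])
  filter_upwards [h.eventually_proportional hS, hne] with u hu hu0
  -- The transported matrix has the entries at `|00⟩` and `|22⟩` interchanged, so this entry says
  -- that their squares agree. Their sum is `2` at `u = 1`, which excludes the opposite sign.
  have e := congrFun (congrFun hu (2, 2)) (2, 2)
  simp only [Matrix.smul_apply, weightedReindex_apply, smul_eq_mul, mul_inv_cancel, Units.val_one,
    inv_one, one_mul, mul_one] at e
  have e' : R u (0, 0) (0, 0) * R u (0, 0) (0, 0) = R u (2, 2) (2, 2) * R u (2, 2) (2, 2) := e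
  exact sub_eq_zero.1 ((mul_eq_zero.1 (by linear_combination e' :
    (R u (0, 0) (0, 0) + R u (2, 2) (2, 2)) * (R u (0, 0) (0, 0) - R u (2, 2) (2, 2)) = 0)
    ).resolve_left hu0)

-- Terms of `H` preserve the parity of the number of `1`s, or are unaffected because `τ₃² = 1`,
-- under `diag(1, τ₃, 1)` on both sites. Charge conjugation with site exchange swaps the 0–1 and 1–2
-- hoppings, whose ratio `τ₃` is absorbed by the twist with `c₁² = τ₃`. The condition on `a` makes
-- the telescopic term invariant.
set_option maxHeartbeats 2000000 in
theorem shiftedSpRHamiltonian_symmetric {θ₀ τ₃ κ α : ℂ} {a : Fin 3 → ℂ} (hτ : τ₃ ^ 2 = 1)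
    (hθ : θ₀ = 2 - τ₃) (ha : 2 * a 1 = a 0 + a 2) {c : Fin 3 → ℂˣ} (h0 : c 0 = 1) (h2 : c 2 = 1)
    (h1 : (c 1 : ℂ) ^ 2 = τ₃) :
    weightedReindex 1 (fun x => c x.1 ^ 2 * c x.2 ^ 2) (shiftedSpRHamiltonian θ₀ τ₃ κ α 0 a)
        = shiftedSpRHamiltonian θ₀ τ₃ κ α 0 a ∧
      weightedReindex revSwap (fun x => c x.1 * (c x.2)⁻¹) (shiftedSpRHamiltonian θ₀ τ₃ κ α 0 a)
        = shiftedSpRHamiltonian θ₀ τ₃ κ α 0 a := by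
  have hinv : ((c 1)⁻¹ : ℂ) = τ₃ * c 1 := by
    have : (c 1 : ℂ) ≠ 0 := (c 1).ne_zero
    field_simp
    linear_combination -hτ - τ₃ * h1
  have hτi : τ₃⁻¹ = τ₃ := by
    have : τ₃ ≠ 0 := by rintro rfl; norm_num at hτ
    field_simp
    exact hτ.symm
  have ha2 : a 2 = 2 * a 1 - a 0 := by linear_combination -ha
  constructor
  · ext ⟨i, j⟩ ⟨k, l⟩
    simp only [weightedReindex_apply, Equiv.Perm.one_apply, shiftedSpRHamiltonian_apply]
    fin_cases i <;> fin_cases j <;> fin_cases k <;> fin_cases l <;>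
      simp [spREntry, h0, h1, h2, hτi, hτ, hθ] <;> grind
  · ext ⟨i, j⟩ ⟨k, l⟩
    simp only [weightedReindex_apply, revSwap, Equiv.trans_apply, Equiv.prodComm_apply,
      Equiv.prodCongr_apply, Prod.map, Prod.swap, Fin.revPerm_apply, shiftedSpRHamiltonian_apply]
    fin_cases i <;> fin_cases j <;> fin_cases k <;> fin_cases l <;>
      simp [spREntry, h0, h2, hinv, hτ, hθ] <;> grind

theorem spR_diagonal_entries_eq {θ₀ τ₃ κ α : ℂ} {a : Fin 3 → ℂ} {R : ℂ → TwoSite}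
    (hτ : τ₃ ^ 2 = 1) (hθ : θ₀ = 2 - τ₃) (ha : 2 * a 1 = a 0 + a 2)
    (h : IsRegularRMatrixFor (shiftedSpRHamiltonian θ₀ τ₃ κ α 0 a) R) :
    ∀ᶠ u in 𝓝 (1 : ℂ), R u (0, 0) (0, 0) = R u (2, 2) (2, 2) := by
  -- The twist is `c = diag(1, ω, 1)` with `ω² = τ₃`; then `c⁴ = 1` because `τ₃² = 1`.
  obtain ⟨ω, hω⟩ := IsAlgClosed.exists_pow_nat_eq τ₃ two_pos
  have hω4 : ω ^ 4 = 1 := by linear_combination (ω ^ 2 + τ₃) * hω + hτ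
  have hω0 : ω ≠ 0 := by rintro rfl; norm_num at hω4
  let c : Fin 3 → ℂˣ := ![1, Units.mk0 ω hω0, 1]
  have hc : ∀ i, c i ^ 4 = 1 := by
    intro i
    fin_cases i
    · simp [c]
    · ext; simpa [c] using hω4
    · simp [c]
  have hrev : ∀ i, c i.rev = c i := by
    intro i
    fin_cases i <;> rfl
  have hs := shiftedSpRHamiltonian_symmetric (κ := κ) (α := α) hτ hθ ha (c := c) rfl rfl hω
  exact h.eventually_eq_of_revSwap c hc hrev hs.1 hs.2

/-! ### The main theorem. -/

theorem mainTheorem2 (θ₀ τ₃ κ : ℂ) (hθ : θ₀ ≠ 0) (hτ : τ₃ ≠ 0) (hκ : κ ≠ 0) :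
    (∀ (α : ℂ) (a : Fin 3 → ℂ) (Rc : ℂ → TwoSite),
      IsRegularRMatrixFor
          (spRHamiltonian θ₀ τ₃ κ + α • (1 : TwoSite) + telescopic a) Rc →
        (∀ᶠ u in 𝓝 (1 : ℂ),
          unbraid (Rc u) (0, 0) (0, 0) = τ₃ ^ 2 * unbraid (Rc u) (2, 2) (2, 2)) ∧
        τ₃ ^ 2 = 1 ∧ θ₀ = τ₃ ^ 2 - τ₃ + 1) ∧
    (¬ (τ₃ ^ 2 = 1 ∧ θ₀ = τ₃ ^ 2 - τ₃ + 1) →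
      ∀ (α : ℂ) (a : Fin 3 → ℂ),
        ¬ ∃ Rc : ℂ → TwoSite,
          IsRegularRMatrixFor
            (spRHamiltonian θ₀ τ₃ κ + α • (1 : TwoSite) + telescopic a) Rc) ∧
    (θ₀ ≠ τ₃ ^ 2 - τ₃ + 1 →
      ∀ (α β : ℂ) (a : Fin 3 → ℂ),
        ¬ ∃ Rc : ℂ → TwoSite,
          IsRegularRMatrixFor
            (spRHamiltonian θ₀ τ₃ κ + α • (1 : TwoSite) + β • twoSiteSpin + telescopic a) Rc) := by
  have h0 : ∀ (α : ℂ) (a : Fin 3 → ℂ), spRHamiltonian θ₀ τ₃ κ + α • (1 : TwoSite) + telescopic a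
      = shiftedSpRHamiltonian θ₀ τ₃ κ α 0 a := fun α a => by
    rw [shiftedSpRHamiltonian, zero_smul, add_zero]
  have main : ∀ (α : ℂ) (a : Fin 3 → ℂ) (Rc : ℂ → TwoSite),
      IsRegularRMatrixFor
          (spRHamiltonian θ₀ τ₃ κ + α • (1 : TwoSite) + telescopic a) Rc →
        (∀ᶠ u in 𝓝 (1 : ℂ),
          unbraid (Rc u) (0, 0) (0, 0) = τ₃ ^ 2 * unbraid (Rc u) (2, 2) (2, 2)) ∧
        τ₃ ^ 2 = 1 ∧ θ₀ = τ₃ ^ 2 - τ₃ + 1 := by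
    intro α a Rc h
    rw [h0] at h
    have h1 : τ₃ ^ 2 = 1 := by linear_combination spR_tau_sq hθ hτ hκ h
    have h2 := spR_theta_eq hθ hτ hκ h
    refine ⟨?_, h1, h2⟩
    filter_upwards [spR_diagonal_entries_eq h1 (by linear_combination h2 + h1)
      (shift_of_isRegularRMatrixFor hθ hτ hκ h) h] with u hu
    rw [h1, one_mul]
    -- The permutation fixes `|00⟩` and `|22⟩`, so these two entries of `R` and `Rc` coincide by
    -- definition.
    exact hu
  refine ⟨main, fun hne α a ⟨Rc, h⟩ => hne (main α a Rc h).2, fun hne α β a ⟨Rc, h⟩ => ?_⟩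
  exact hne (spR_theta_eq hθ hτ hκ h)
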